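/- Let $G$ be a connected simple graph with $N$ vertices and $K\ge 2$ edges, and let $\mathbb F_q$ be a finite field. Vertices are servers; each edge $k$ carries a message $W_k$ of $L$ symbols, all symbols being i.i.d. uniform on $\mathbb F_q$, and server $i$ stores the set $\mathcal W_i$ of messages of the edges incident to it. With fully-replicated randomness all servers also share a random variable $\mathcal R$ on a finite set. The user has private randomness $\mathcal Q$ (finite-valued), and $\mathcal Q,\mathcal W,\mathcal R$ are independent. To retrieve $W_k$ the user sends to each server $i$ a query $Q_i^{[k]}$, a function of $\mathcal Q$ (and $k$); server $i$ returns an answer $A_i^{[k]}$, a tuple of symbols of $\mathbb F_q$ whose length depends only on $i$, that is a function of $(Q_i^{[k]},\mathcal W_i,\mathcal R)$. Entropies are in $q$-ary units. An *SPIR scheme with fully-replicated randomness* is such a scheme with $L\ge 1$ that satisfies, for all $i,k,k'$: - (user privacy) $(Q_i^{[k]},A_i^{[k]},\mathcal W_i,\mathcal R)\sim(Q_i^{[k']},A_i^{[k']},\mathcal W_i,\mathcal R)$; - (reliability) $H(W_k\mid A_1^{[k]},\dots,A_N^{[k]},\mathcal Q)=0$; - (database privacy) $I(\mathcal W\setminus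 W_k;A_1^{[k]},\dots,A_N^{[k]}\mid\mathcal Q)=0$. Its rate is $L/\sum_i H(A_i^{[k]})$ and its total randomness ratio is $H(\mathcal R)/L$. The capacity $\mathscr C_{FR}(G)$ is the supremum of the rates, and $\rho^*_{total}(G)$ the infimum of the total randomness ratios, of all such schemes. A *PIR scheme* has no common randomness and has to satisfy only user privacy and reliability; it is *linear* if, for every query, each server's answer is an $\mathbb F_q$-linear function of its stored messages (in particular if all downloaded symbols are sums of message symbols). It has the *symmetric retrieval property* if $H(A_i^{[k]}\mid Q_i^{[k]},\mathcal W_i\setminus\{W_k\})=H(W_k)/2$ for every $k$ and both servers $i$ storing $W_k$. **Theorem.** Suppose that a linear PIR scheme on $G$ over $\mathbb F_q$ has the symmetric retrieval property, uses an even number $L'$ of symbols per message, and downloads $D'$ symbols in total. Put $\ell=\operatorname{lcm}(L'/2,N-1)$, $x=\ell/(L'/2)$ and $y=\ell/(N-1)$. Then there is an SPIR scheme on $G$ over $\mathbb F_q$ with fully-replicated randomness whose rate, for every desired message, is $$\frac{L'x}{D'x+Ny},$$ and whose total randomness ratio is $$\frac{K-1}{2}+\frac{Ny}{L'x}.$$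 Consequently $\frac{L'x}{D'x+Ny}\le\mathscr C_{FR}(G)$ and $\rho^*_{total}(G)\le\frac{K-1}{2}+\frac{Ny}{L'x}$. -/

import Mathlib

noncomputable section

namespace GraphPIR

/-! ### Shannon information of finitely supported random variables -/

section Entropy

variable {S α β γ : Type*}

/-- Shannon entropy, in `q`-ary units, of a finitely supported law `p`. -/
def lawEntropy (q : ℕ) (p : PMF α) : ℝ :=
  ∑ᶠ a, Real.negMulLog (p a).toReal / Real.log q

/-- `H(X)` for a random variable `X` on the probability space `(S, P)`. -/
def entropy (q : ℕ) (P : PMF S) (X : S → α) : ℝ :=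
  lawEntropy q (P.map X)

/-- `H(X | Y) = H(X, Y) - H(Y)`. -/
def condEntropy (q : ℕ) (P : PMF S) (X : S → α) (Y : S → β) : ℝ :=
  entropy q P (fun s => (X s, Y s)) - entropy q P Y

/-- `I(X ; Y | Z) = H(X | Z) - H(X | Y, Z)`. -/
def condMutualInfo (q : ℕ) (P : PMF S) (X : S → α) (Y : S → β) (Z : S → γ) : ℝ :=
  condEntropy q P X Z - condEntropy q P X (fun s => (Y s, Z s))

end Entropy

/-! ### Retrieval schemes on a graph-replicated database

Servers are the vertices of `G`, messages are the edges of `G`, and a server stores the messages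
of the edges incident to it. -/

/-- A database: one message of `L` symbols of `F` for each edge of `G`. -/
abbrev Messages {V : Type} (F : Type) (G : SimpleGraph V) (L : ℕ) : Type :=
  G.edgeSet → Fin L → F

/-- The (indices of the) messages stored at server `i`. -/
abbrev Stored {V : Type} (G : SimpleGraph V) (i : V) : Type :=
  {e : G.edgeSet // i ∈ (e : Sym2 V)}

/-- A one-round retrieval scheme on `G` whose servers all share a common randomness with values
in `R`. The queries are functions of the desired index and of the user's private randomness;
the answer of server `i`, made of `len i` downloaded symbols of `F`, is a function of its query, its
stored messages and the common randomness. -/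
structure Scheme {V : Type} (F : Type) (G : SimpleGraph V) (R : Type) where
  /-- number of symbols per message -/
  L : ℕ
  L_pos : 0 < L
  /-- alphabet and law of the user's private randomness -/
  UserRand : Type
  finite_userRand : Finite UserRand
  userLaw : PMF UserRand
  /-- law of the common randomness of the servers -/
  randLaw : PMF R
  Query : V → Type
  query : G.edgeSet → UserRand → (i : V) → Query i
  /-- number of symbols downloaded from each server -/
  len : V → ℕ
  answer : (i : V) → Query i → (Stored G i → Fin L → F) → R → (Fin (len i) → F)

/-- In a PIR scheme the servers have no common randomness. -/
abbrev PIRScheme {V : Type} (F : Type) (G : SimpleGraph V) : Type 1 := Scheme F G Unit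

namespace Scheme

variable {V F R : Type} [Fintype V] [Field F] [Fintype F] {G : SimpleGraph V}

/-- The sample space: user's randomness, database, common randomness. -/
abbrev Sample (S : Scheme F G R) : Type := S.UserRand × Messages F G S.L × R

/-- The three components are independent and the message symbols are i.i.d. uniform. -/
def law (S : Scheme F G R) : PMF S.Sample :=
  letI : Fintype (Messages F G S.L) := Fintype.ofFinite _
  S.userLaw.bind fun u =>
    (PMF.uniformOfFintype (Messages F G S.L)).bind fun w =>
      S.randLaw.map fun r => (u, w, r)

/-- The user's randomness. -/
def U (S : Scheme F G R) (s : S.Sample) : S.UserRand := s.1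

/-- The message of edge `k`. -/
def W (S : Scheme F G R) (k : G.edgeSet) (s : S.Sample) : Fin S.L → F := s.2.1 k

/-- All messages except that of edge `k`. -/
def WOther (S : Scheme F G R) (k : G.edgeSet) (s : S.Sample) :
    {e : G.edgeSet // e ≠ k} → Fin S.L → F :=
  fun e => s.2.1 e.1

/-- The messages stored at server `i`. -/
def WStored (S : Scheme F G R) (i : V) (s : S.Sample) : Stored G i → Fin S.L → F :=
  fun e => s.2.1 e.1

/-- The messages stored at server `i`, except that of edge `k`. -/
def WStoredOther (S : Scheme F G R) (i : V) (k : G.edgeSet) (s : S.Sample) :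
    {e : Stored G i // e.1 ≠ k} → Fin S.L → F :=
  fun e => s.2.1 e.1.1

/-- The common randomness. -/
def Rand (S : Scheme F G R) (s : S.Sample) : R := s.2.2

/-- The query to server `i` when message `k` is desired. -/
def Q (S : Scheme F G R) (k : G.edgeSet) (i : V) (s : S.Sample) : S.Query i :=
  S.query k s.1 i

/-- The answer of server `i` when message `k` is desired. -/
def A (S : Scheme F G R) (k : G.edgeSet) (i : V) (s : S.Sample) : Fin (S.len i) → F :=
  S.answer i (S.Q k i s) (S.WStored i s) (S.Rand s)

/-- The answers of all servers when message `k` is desired. -/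
def AAll (S : Scheme F G R) (k : G.edgeSet) (s : S.Sample) : (i : V) → Fin (S.len i) → F :=
  fun i => S.A k i s

/-- What server `i` sees has the same law for any two desired indices. -/
def UserPrivacy (S : Scheme F G R) : Prop :=
  ∀ (i : V) (k k' : G.edgeSet),
    S.law.map (fun s => (S.Q k i s, S.A k i s, S.WStored i s, S.Rand s)) =
      S.law.map (fun s => (S.Q k' i s, S.A k' i s, S.WStored i s, S.Rand s))

/-- `H(W_k | A_1, …, A_N, 𝒬) = 0` for every `k`. -/
def Reliable (S : Scheme F G R) : Prop :=
  ∀ k : G.edgeSet,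
    condEntropy (Fintype.card F) S.law (S.W k) (fun s => (S.AAll k s, S.U s)) = 0

/-- `I(W_{k̄} ; A_1, …, A_N | 𝒬) = 0` for every `k`. -/
def DatabasePrivacy (S : Scheme F G R) : Prop :=
  ∀ k : G.edgeSet,
    condMutualInfo (Fintype.card F) S.law (S.WOther k) (S.AAll k) S.U = 0

/-- The requirements on a PIR scheme. -/
def IsPIR (S : Scheme F G Unit) : Prop := S.UserPrivacy ∧ S.Reliable

/-- The requirements on an SPIR scheme with fully-replicated common randomness. -/
def IsSPIR (S : Scheme F G R) : Prop := S.UserPrivacy ∧ S.Reliable ∧ S.DatabasePrivacy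

/-- For every query, the answer of each server is an `F`-linear function of the messages stored
there. -/
def IsLinear (S : Scheme F G Unit) : Prop :=
  ∀ (i : V) (q : S.Query i), IsLinearMap F (fun w => S.answer i q w ())

/-- Symmetric retrieval property: `H(A_i | Q_i, W_i ∖ W_k) = H(W_k) / 2` for each of the two servers
`i` that store the desired message `k`. -/
def SymmetricRetrieval (S : Scheme F G Unit) : Prop :=
  ∀ (k : G.edgeSet) (i : V), i ∈ (k : Sym2 V) →
    condEntropy (Fintype.card F) S.law (S.A k i) (fun s => (S.Q k i s, S.WStoredOther i k s)) =
      entropy (Fintype.card F) S.law (S.W k) / 2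

/-- Total number of downloaded symbols. -/
def downloads (S : Scheme F G R) : ℕ := ∑ i, S.len i

/-- `L / ∑ i, H(A_i)` when message `k` is desired. -/
def rate (S : Scheme F G R) (k : G.edgeSet) : ℝ :=
  S.L / ∑ i, entropy (Fintype.card F) S.law (S.A k i)

/-- Total randomness ratio `H(R) / L`. -/
def totalRandRatio (S : Scheme F G R) : ℝ :=
  entropy (Fintype.card F) S.law S.Rand / S.L

end Scheme

section Metrics

variable {V : Type} (F : Type) [Fintype V] [Field F] [Fintype F] (G : SimpleGraph V)

/-- SPIR capacity of `G` over `F` with fully-replicated randomness: the supremum, in the extended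
reals, of all achievable rates. -/
def capacityFR : EReal :=
  sSup {r : EReal | ∃ (R : Type) (_ : Finite R) (S : Scheme F G R), S.IsSPIR ∧
    ∀ k, r = (S.rate k : EReal)}

/-- Optimum total randomness ratio: the infimum, in the extended reals, over all feasible SPIR
schemes with fully-replicated randomness. -/
def optTotalRandRatio : EReal :=
  sInf {r : EReal | ∃ (R : Type) (_ : Finite R) (S : Scheme F G R), S.IsSPIR ∧
    r = (S.totalRandRatio : EReal)}

end Metrics

end GraphPIR

end

/-!
Repeat the given scheme along a finite sample of the private randomness of its user that satisfies
every integral linear relation between the probabilities. For any two desired messages, the queries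
to a server in the `M` copies then agree up to a permutation of the copies, and symmetric retrieval
makes each server see each of its messages through a linear map of rank `n = M * L / 2`.

The kernels of the two views of an undesired message have a common complement, so after an
invertible change of coordinates both servers see it through the same projection onto an
`n`-dimensional space. One `n`-dimensional mask per message, shared by all servers, therefore hides
the undesired messages, and a secret random change of coordinates hides which message is desired.

To decode, the user needs only the mask of the desired message, which is itself retrieved
privately: the masks are stored by all `N` servers, so with `n = (N - 1) * m` one answer of length
`m` per server suffices, protected by one key of length `m`. A pad drawn by the user makes all
answers uniform, so that their entropies are their lengths.
-/

namespace GraphPIR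

section Entropy

variable {S α β : Type*}

lemma apply_eq_one_of_unique [Unique α] (p : PMF α) (a : α) : p a = 1 := by
  have h := p.tsum_coe
  rwa [tsum_fintype, Fintype.sum_unique, Unique.default_eq a] at h

lemma toReal_map_pos (P : PMF S) (X : S → α) {s : S} (hs : P s ≠ 0) :
    0 < (P.map X (X s)).toReal := by
  refine ENNReal.toReal_pos ?_ (PMF.apply_ne_top _ _)
  rw [← PMF.mem_support_iff, PMF.support_map]
  exact ⟨s, hs, rfl⟩

lemma map_apply_le (P : PMF S) {X : S → α} {Y : S → β} {a : α} {b : β}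
    (h : ∀ s, X s = a → Y s = b) : P.map X a ≤ P.map Y b := by
  simp only [PMF.map_apply]
  refine ENNReal.tsum_le_tsum fun s => ?_
  by_cases hs : X s = a
  · rw [if_pos hs.symm, if_pos (h s hs).symm]
  · rw [if_neg (Ne.symm hs)]
    exact zero_le

lemma map_apply_congr (P : PMF S) {X : S → α} {Y : S → β} {a : α} {b : β}
    (h : ∀ s, X s = a ↔ Y s = b) : P.map X a = P.map Y b :=
  le_antisymm (map_apply_le P fun s => (h s).1) (map_apply_le P fun s => (h s).2)

lemma map_apply_lt (P : PMF S) {X : S → α} {Y : S → β} {a : α} {b : β}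
    (h : ∀ s, X s = a → Y s = b) {t : S} (ht : P t ≠ 0) (hX : X t ≠ a) (hY : Y t = b) :
    P.map X a < P.map Y b := by
  have htop := (P.map X).apply_ne_top a
  simp only [PMF.map_apply] at htop ⊢
  refine ENNReal.tsum_lt_tsum (i := t) htop (fun s => ?_) ?_
  · by_cases hs : X s = a
    · rw [if_pos hs.symm, if_pos (h s hs).symm]
    · rw [if_neg (Ne.symm hs)]
      exact zero_le
  · rw [if_neg (Ne.symm hX), if_pos hY.symm]
    exact pos_iff_ne_zero.2 ht

lemma sum_map_prodMk_apply [Fintype α] (P : PMF S) (X : S → α) (Y : S → β) (b : β) :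
    ∑ a, P.map (fun s => (X s, Y s)) (a, b) = P.map Y b := by
  classical
  simp only [PMF.map_apply, Prod.mk.injEq]
  rw [← Summable.tsum_finsetSum fun _ _ => ENNReal.summable]
  refine tsum_congr fun s => ?_
  rw [Finset.sum_eq_single (X s) (fun a _ ha => if_neg fun h => ha h.1)
    fun h => absurd (Finset.mem_univ _) h]
  simp only [true_and]

section Fintype

variable [Fintype S]

lemma sum_toReal (P : PMF S) : ∑ s, (P s).toReal = 1 := by
  rw [← ENNReal.toReal_sum fun s _ => P.apply_ne_top s, ← tsum_fintype (L := .unconditional _),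
    P.tsum_coe, ENNReal.toReal_one]

lemma toReal_map_apply [DecidableEq α] (P : PMF S) (X : S → α) (a : α) :
    (P.map X a).toReal = ∑ s with X s = a, (P s).toReal := by
  rw [PMF.map_apply, tsum_fintype, Finset.sum_filter, ENNReal.toReal_sum]
  · refine Finset.sum_congr rfl fun s _ => ?_
    by_cases h : X s = a
    · simp [h]
    · simp [h, Ne.symm h]
  · intro s _
    split_ifs
    exacts [P.apply_ne_top s, ENNReal.zero_ne_top]

lemma sum_toReal_map_mul [Fintype α] (P : PMF S) (X : S → α) (g : α → ℝ) :
    ∑ a, (P.map X a).toReal * g a = ∑ s, (P s).toReal * g (X s) := by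
  classical
  rw [← Finset.sum_fiberwise Finset.univ X]
  refine Finset.sum_congr rfl fun a _ => ?_
  rw [toReal_map_apply, Finset.sum_mul]
  exact Finset.sum_congr rfl fun s hs => by rw [(Finset.mem_filter.1 hs).2]

lemma entropy_eq_sum (q : ℕ) (P : PMF S) (X : S → α) :
    entropy q P X = ∑ s, (P s).toReal * -Real.logb q (P.map X (X s)).toReal := by
  classical
  have hsupp : Function.support (fun a => Real.negMulLog (P.map X a).toReal / Real.log q) ⊆
      (Finset.univ.image X : Finset α) := by
    intro a ha
    by_contra hne
    have : (P.map X a).toReal = 0 := by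
      rw [toReal_map_apply, Finset.filter_false_of_mem fun s _ h => hne (by simp [← h]),
        Finset.sum_empty]
    exact ha (by simp only [this, Real.negMulLog_zero, zero_div])
  rw [entropy, lawEntropy, finsum_eq_sum_of_support_subset _ hsupp,
    ← Finset.sum_fiberwise_of_maps_to (g := X) fun s _ =>
      Finset.mem_image_of_mem X (Finset.mem_univ s)]
  refine Finset.sum_congr rfl fun a _ => ?_
  rw [Finset.sum_congr rfl fun s hs => by rw [(Finset.mem_filter.1 hs).2], ← Finset.sum_mul,
    ← toReal_map_apply P X a, Real.negMulLog, Real.logb]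
  ring

lemma condEntropy_eq_sum (q : ℕ) (P : PMF S) (X : S → α) (Y : S → β) :
    condEntropy q P X Y = ∑ s, (P s).toReal *
      Real.logb q ((P.map Y (Y s)).toReal / (P.map (fun t => (X t, Y t)) (X s, Y s)).toReal) := by
  rw [condEntropy, entropy_eq_sum, entropy_eq_sum, ← Finset.sum_sub_distrib]
  refine Finset.sum_congr rfl fun s _ => ?_
  by_cases hs : P s = 0
  · simp [hs]
  · rw [Real.logb_div (toReal_map_pos P Y hs).ne'
      (toReal_map_pos P (fun t => (X t, Y t)) hs).ne']
    ring

lemma condEntropy_eq_sum_of_toReal_map_eq_mul {q : ℕ} {P : PMF S} {X : S → α} {Y : S → β}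
    (c : S → ℝ) (h : ∀ s, (P.map Y (Y s)).toReal =
      c s * (P.map (fun t => (X t, Y t)) (X s, Y s)).toReal) :
    condEntropy q P X Y = ∑ s, (P s).toReal * Real.logb q (c s) := by
  rw [condEntropy_eq_sum]
  refine Finset.sum_congr rfl fun s _ => ?_
  by_cases hs : P s = 0
  · simp [hs]
  · rw [h, mul_div_cancel_right₀ _ (toReal_map_pos P (fun t => (X t, Y t)) hs).ne']

end Fintype

section Finite

variable [Finite S]

lemma condEntropy_const (q : ℕ) (P : PMF S) (X : S → α) (b : β) :
    condEntropy q P X (fun _ => b) = entropy q P X := by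
  have := Fintype.ofFinite S
  have hb : P.map (fun _ => b) b = 1 := by
    rw [map_apply_congr P (X := fun _ => b) (Y := fun _ => ()) (b := ()) fun _ => by simp,
      apply_eq_one_of_unique]
  rw [condEntropy_eq_sum, entropy_eq_sum]
  refine Finset.sum_congr rfl fun s _ => ?_
  rw [map_apply_congr P (X := fun t => (X t, b)) (Y := X) (b := X s) fun t => by simp, hb,
    ENNReal.toReal_one, one_div, Real.logb_inv]

lemma condEntropy_eq_zero_of_function (q : ℕ) (P : PMF S) {X : S → α} {Y : S → β}
    (h : ∀ s t, Y s = Y t → X s = X t) : condEntropy q P X Y = 0 := by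
  have := Fintype.ofFinite S
  rw [condEntropy_eq_sum_of_toReal_map_eq_mul (fun _ => 1)]
  · simp
  · intro s
    rw [one_mul]
    exact congrArg _ (map_apply_congr P fun t => by simpa using h t s)

lemma eq_of_condEntropy_eq_zero {q : ℕ} (hq : 1 < q) {P : PMF S} {X : S → α} {Y : S → β}
    (h : condEntropy q P X Y = 0) {s t : S} (hs : P s ≠ 0) (ht : P t ≠ 0) (hst : Y s = Y t) :
    X s = X t := by
  have := Fintype.ofFinite S
  have hq' : (1 : ℝ) < q := Nat.one_lt_cast.2 hq
  have hfst (s : S) : ∀ t, (X t, Y t) = (X s, Y s) → Y t = Y s := fun t h => (Prod.mk.inj h).2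
  rw [condEntropy_eq_sum, Finset.sum_eq_zero_iff_of_nonneg] at h
  · by_contra hne
    have hlt := ENNReal.toReal_strict_mono (PMF.apply_ne_top _ _)
      (map_apply_lt P (hfst s) ht (fun h => hne (Prod.mk.inj h).1.symm) hst.symm)
    have hpos : 0 < Real.logb q ((P.map Y (Y s)).toReal /
        (P.map (fun t => (X t, Y t)) (X s, Y s)).toReal) :=
      Real.logb_pos hq' ((one_lt_div (toReal_map_pos P _ hs)).2 hlt)
    exact (mul_pos (ENNReal.toReal_pos hs (P.apply_ne_top s)) hpos).ne' (h s (Finset.mem_univ s))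
  · intro r _
    by_cases hr : P r = 0
    · simp [hr]
    · exact mul_nonneg ENNReal.toReal_nonneg (Real.logb_nonneg hq'
        ((one_le_div (toReal_map_pos P (fun t => (X t, Y t)) hr)).2
          (ENNReal.toReal_mono (PMF.apply_ne_top _ _) (map_apply_le P (hfst r)))))

end Finite

section Uniform

variable [Fintype S] [Nonempty S]

lemma map_uniformOfFintype_comp_equiv (X : S → α) (π : S ≃ S) :
    (PMF.uniformOfFintype S).map (fun s => X (π s)) = (PMF.uniformOfFintype S).map X := by
  classical
  ext a
  simp only [PMF.map_apply, PMF.uniformOfFintype_apply]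
  exact π.tsum_eq fun s => if a = X s then (Fintype.card S : ENNReal)⁻¹ else 0

lemma condEntropy_uniformOfFintype [AddGroup α] [Fintype α] (q : ℕ) (X : S → α) (Y : S → β)
    (h : ∀ δ : α, ∃ π : S ≃ S, ∀ s, X (π s) = X s + δ ∧ Y (π s) = Y s) :
    condEntropy q (PMF.uniformOfFintype S) X Y = Real.logb q (Fintype.card α) := by
  set P := PMF.uniformOfFintype S
  have hconst (a a' : α) (b : β) :
      P.map (fun t => (X t, Y t)) (a, b) = P.map (fun t => (X t, Y t)) (a', b) := by
    obtain ⟨π, hπ⟩ := h (-a' + a)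
    rw [← DFunLike.congr_fun (map_uniformOfFintype_comp_equiv (fun t => (X t, Y t)) π) (a, b)]
    refine map_apply_congr P fun s => ?_
    rw [Prod.mk.injEq, Prod.mk.injEq, (hπ s).1, (hπ s).2, ← add_assoc, add_eq_right,
      ← sub_eq_add_neg, sub_eq_zero]
  rw [condEntropy_eq_sum_of_toReal_map_eq_mul fun _ => Fintype.card α, ← Finset.sum_mul,
    sum_toReal, one_mul]
  intro s
  rw [← sum_map_prodMk_apply P X Y, Finset.sum_congr rfl fun a _ => hconst a (X s) (Y s)]
  simp

lemma entropy_uniformOfFintype [AddGroup α] [Fintype α] (q : ℕ) (X : S → α)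
    (h : ∀ δ : α, ∃ π : S ≃ S, ∀ s, X (π s) = X s + δ) :
    entropy q (PMF.uniformOfFintype S) X = Real.logb q (Fintype.card α) := by
  rw [← condEntropy_const q _ X (), condEntropy_uniformOfFintype]
  exact fun δ => (h δ).imp fun π hπ s => ⟨hπ s, rfl⟩

end Uniform

end Entropy

section LinearAlgebra

variable {K U E : Type*} [DivisionRing K] [AddCommGroup U] [Module K U] [AddCommGroup E]
  [Module K E]

lemma exists_notMem_notMem_of_ne_top {A B : Submodule K U} (hA : A ≠ ⊤) (hB : B ≠ ⊤) :
    ∃ v, v ∉ A ∧ v ∉ B := by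
  obtain ⟨a, ha⟩ := SetLike.exists_not_mem_of_ne_top A hA
  obtain ⟨b, hb⟩ := SetLike.exists_not_mem_of_ne_top B hB
  by_cases haB : a ∈ B
  · by_cases hbA : b ∈ A
    · exact ⟨a + b, fun h => ha ((A.add_mem_iff_left hbA).1 h),
        fun h => hb ((B.add_mem_iff_right haB).1 h)⟩
    · exact ⟨b, hbA, hb⟩
  · exact ⟨a, ha, haB⟩

lemma isCompl_span_singleton_sup {A C : Submodule K U} {v : U} (hv : v ∉ A)
    (h : IsCompl C (A ⊔ K ∙ v)) : IsCompl (C ⊔ K ∙ v) A := by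
  have hv0 : v ≠ 0 := fun h0 => hv (h0 ▸ A.zero_mem)
  have hA : Disjoint A (K ∙ v) := (Submodule.disjoint_span_singleton' hv0).2 hv
  refine ⟨?_, ?_⟩
  · exact (hA.disjoint_sup_right_of_disjoint_sup_left h.symm.disjoint).symm.mono_left
      (sup_comm C _).le
  · rw [codisjoint_iff, sup_assoc, sup_comm _ A]
    exact h.sup_eq_top

lemma exists_common_isCompl [FiniteDimensional K U] {A B : Submodule K U}
    (h : Module.finrank K A = Module.finrank K B) : ∃ C, IsCompl C A ∧ IsCompl C B := by
  by_cases hA : A = ⊤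
  · have hB : B = ⊤ := Submodule.eq_top_of_finrank_eq (by rw [← h, hA, finrank_top])
    exact ⟨⊥, hA ▸ isCompl_bot_top, hB ▸ isCompl_bot_top⟩
  have hB : B ≠ ⊤ := fun hB => hA (Submodule.eq_top_of_finrank_eq (by rw [h, hB, finrank_top]))
  obtain ⟨v, hvA, hvB⟩ := exists_notMem_notMem_of_ne_top hA hB
  obtain ⟨C, hCA, hCB⟩ := exists_common_isCompl
    (A := A ⊔ K ∙ v) (B := B ⊔ K ∙ v) (by
      rw [Submodule.finrank_sup_span_singleton hvA, Submodule.finrank_sup_span_singleton hvB, h])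
  exact ⟨C ⊔ K ∙ v, isCompl_span_singleton_sup hvA hCA, isCompl_span_singleton_sup hvB hCB⟩
termination_by Module.finrank K U - Module.finrank K A
decreasing_by
  have := Submodule.finrank_lt hA
  have := Submodule.finrank_sup_span_singleton hvA
  omega

lemma bijective_domRestrict_of_isCompl_ker {X : U →ₗ[K] E} (hX : Function.Surjective X)
    {C : Submodule K U} (hC : IsCompl C X.ker) : Function.Bijective (X.domRestrict C) := by
  refine ⟨LinearMap.injective_domRestrict_iff.2 hC.disjoint, ?_⟩
  rw [← LinearMap.range_eq_top, LinearMap.range_domRestrict,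
    LinearMap.map_eq_top_iff (LinearMap.range_eq_top.2 hX), hC.sup_eq_top]

lemma finrank_ker_eq_of_surjective [FiniteDimensional K U] {X Y : U →ₗ[K] E}
    (hX : Function.Surjective X) (hY : Function.Surjective Y) :
    Module.finrank K X.ker = Module.finrank K Y.ker := by
  have h1 := X.finrank_range_add_finrank_ker
  have h2 := Y.finrank_range_add_finrank_ker
  rw [LinearMap.range_eq_top.2 hX] at h1
  rw [LinearMap.range_eq_top.2 hY] at h2
  lia

lemma exists_common_section [FiniteDimensional K U] {X Y : U →ₗ[K] E}
    (hX : Function.Surjective X) (hY : Function.Surjective Y) :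
    ∃ s : E →ₗ[K] U, Function.Bijective (X ∘ₗ s) ∧ Function.Bijective (Y ∘ₗ s) := by
  obtain ⟨C, hCX, hCY⟩ := exists_common_isCompl (finrank_ker_eq_of_surjective hX hY)
  have hX' := bijective_domRestrict_of_isCompl_ker hX hCX
  have hY' := bijective_domRestrict_of_isCompl_ker hY hCY
  let e := LinearEquiv.ofBijective _ hX'
  exact ⟨C.subtype ∘ₗ e.symm, hX'.comp e.symm.bijective, hY'.comp e.symm.bijective⟩

lemma exists_equiv_ker_prod {X : U →ₗ[K] E} (hX : Function.Surjective X) :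
    ∃ φ : U ≃ₗ[K] X.ker × E, ∀ u, (φ u).2 = X u := by
  obtain ⟨p, hp⟩ := X.ker.subtype.exists_leftInverse_of_injective X.ker.ker_subtype
  have hp' (x : X.ker) : p x = x := LinearMap.congr_fun hp x
  exact ⟨p.equivProdOfSurjectiveOfIsCompl X (LinearMap.range_eq_of_proj hp')
    (LinearMap.range_eq_top.2 hX) (LinearMap.isCompl_of_proj hp').symm, fun _ => rfl⟩

lemma exists_equiv_comp_eq [FiniteDimensional K U] {X Y : U →ₗ[K] E}
    (hX : Function.Surjective X) (hY : Function.Surjective Y) :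
    ∃ c : U ≃ₗ[K] U, ∀ u, X (c u) = Y u := by
  obtain ⟨φ, hφ⟩ := exists_equiv_ker_prod hX
  obtain ⟨ψ, hψ⟩ := exists_equiv_ker_prod hY
  let κ : Y.ker ≃ₗ[K] X.ker := LinearEquiv.ofFinrankEq _ _ (finrank_ker_eq_of_surjective hY hX)
  refine ⟨ψ ≪≫ₗ κ.prodCongr (LinearEquiv.refl K E) ≪≫ₗ φ.symm, fun u => ?_⟩
  rw [← hφ, ← hψ]
  simp

lemma natCard_fiber [Finite U] {A : Type*} [AddCommGroup A] [Module K A] (f : U →ₗ[K] A) (u₀ : U) :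
    Nat.card {u // f u = f u₀} = Nat.card K ^ Module.finrank K f.ker := by
  rw [← Module.natCard_eq_pow_finrank]
  exact Nat.card_congr ((Equiv.subRight u₀).subtypeEquiv fun u => by simp [sub_eq_zero])

lemma finrank_ker_eq_finrank_map_add [FiniteDimensional K U] {A B : Type*} [AddCommGroup A]
    [Module K A] [AddCommGroup B] [Module K B] (f : U →ₗ[K] A) (g : U →ₗ[K] B) :
    Module.finrank K f.ker = Module.finrank K (f.ker.map g) + Module.finrank K (g.prod f).ker := by
  have hker : (g.prod f).ker = (g.domRestrict f.ker).ker.map f.ker.subtype := by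
    ext u
    simp [and_comm]
  rw [hker, Submodule.finrank_map_subtype_eq, ← LinearMap.range_domRestrict,
    LinearMap.finrank_range_add_finrank_ker]

lemma natCard_fiber_eq_pow_mul [Finite U] {A B : Type*} [AddCommGroup A] [Module K A]
    [AddCommGroup B] [Module K B] (f : U →ₗ[K] A) (g : U →ₗ[K] B) (u₀ : U) :
    Nat.card {u // f u = f u₀} = Nat.card K ^ Module.finrank K (f.ker.map g) *
      Nat.card {u // (g u, f u) = (g u₀, f u₀)} := by
  rw [natCard_fiber, finrank_ker_eq_finrank_map_add f g, pow_add, ← natCard_fiber (g.prod f) u₀]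
  rfl

lemma exists_factorization_pi {I : Type*} [Fintype I] {A B : I → Type*} [∀ j, AddCommGroup (A j)]
    [∀ j, Module K (A j)] [∀ j, FiniteDimensional K (A j)] [∀ j, AddCommGroup (B j)]
    [∀ j, Module K (B j)] (f : (j : I) → A j →ₗ[K] B j) {n : ℕ}
    (hn : ∑ j, Module.finrank K (f j).range = n) :
    ∃ (C : (Fin n → K) →ₗ[K] ((j : I) → B j)) (X : ((j : I) → A j) →ₗ[K] (Fin n → K)),
      Function.Surjective X ∧ ∀ w, C (X w) = fun j => f j (w j) := by
  let φ : ((j : I) → (f j).range) ≃ₗ[K] (Fin n → K) :=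
    LinearEquiv.ofFinrankEq _ _ (by rw [Module.finrank_pi_fintype, hn, Module.finrank_fin_fun])
  let R := LinearMap.piMap fun j => (f j).rangeRestrict
  have hR : Function.Surjective R :=
    Function.Surjective.piMap fun j => (f j).surjective_rangeRestrict
  refine ⟨LinearMap.piMap (fun j => (f j).range.subtype) ∘ₗ φ.symm, φ ∘ₗ R, φ.surjective.comp hR,
    fun w => ?_⟩
  rw [LinearMap.comp_apply, LinearMap.comp_apply, LinearEquiv.coe_coe, LinearEquiv.coe_coe,
    φ.symm_apply_apply]
  rfl

end LinearAlgebra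

section BalancedSample

lemma exists_rat_linearMap_pos {H ι : Type*} [AddCommGroup H] [Module ℚ H] [FiniteDimensional ℚ H]
    [Finite ι] (f : H →ₗ[ℚ] ℝ) (v : ι → H) :
    ∃ φ : H →ₗ[ℚ] ℚ, ∀ i, 0 < f (v i) → 0 < φ (v i) := by
  let b := Module.finBasis ℚ H
  let g (i : ι) (t : Fin (Module.finrank ℚ H) → ℝ) : ℝ := ∑ j, b.repr (v i) j • t j
  have hopen : IsOpen {t | ∀ i, 0 < f (v i) → 0 < g i t} := by
    simp only [Set.ofPred_forall]
    refine isOpen_iInter_of_finite fun i => isOpen_iInter_of_finite fun _ => ?_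
    exact isOpen_lt continuous_const (by fun_prop)
  have hdense : DenseRange (Pi.map fun (_ : Fin (Module.finrank ℚ H)) (r : ℚ) => (r : ℝ)) :=
    DenseRange.piMap fun _ => Rat.denseRange_cast
  have hmem (i : ι) : g i (fun j => f (b j)) = f (v i) := by
    rw [← b.sum_repr (v i), map_sum]
    simp [g]
  obtain ⟨t, ht⟩ := hdense.exists_mem_open hopen ⟨fun j => f (b j), fun i hi => by rwa [hmem]⟩
  refine ⟨b.constr ℚ t, fun i hi => ?_⟩
  have hcast : ((b.constr ℚ t (v i) : ℚ) : ℝ) = g i (Pi.map (fun _ (r : ℚ) => (r : ℝ)) t) := by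
    simp [g, Module.Basis.constr_apply_fintype, Rat.smul_def]
  exact_mod_cast (ht i hi).trans_eq hcast.symm

lemma exists_rat_weights {ι : Type*} [Fintype ι] {x : ι → ℝ} (hx : ∀ i, 0 ≤ x i) :
    ∃ r : ι → ℚ≥0, (∀ i, r i = 0 ↔ x i = 0) ∧
      ∀ c : ι → ℤ, ∑ i, c i * x i = 0 → ∑ i, c i * (r i : ℚ) = 0 := by
  let H := Submodule.span ℚ (Set.range x)
  have : FiniteDimensional ℚ H := FiniteDimensional.span_of_finite ℚ (Set.finite_range x)
  let v (i : ι) : H := ⟨x i, Submodule.subset_span ⟨i, rfl⟩⟩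
  obtain ⟨φ, hφ⟩ := exists_rat_linearMap_pos H.subtype v
  have hφ0 {i : ι} (hi : x i = 0) : φ (v i) = 0 := by
    rw [show v i = 0 from Subtype.ext hi, map_zero]
  have hφpos {i : ι} (hi : x i ≠ 0) : 0 < φ (v i) := hφ i ((hx i).lt_of_ne' hi)
  have hφnonneg (i : ι) : 0 ≤ φ (v i) := by
    by_cases hi : x i = 0
    exacts [(hφ0 hi).ge, (hφpos hi).le]
  have hcoe (i : ι) : ((φ (v i)).toNNRat : ℚ) = φ (v i) := Rat.coe_toNNRat _ (hφnonneg i)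
  refine ⟨fun i => (φ (v i)).toNNRat, fun i => ?_, fun c hc => ?_⟩
  · rw [← NNRat.coe_eq_zero, hcoe]
    exact ⟨fun h => by_contra fun hi => (hφpos hi).ne' h, hφ0⟩
  · have hv : ∑ i, c i • v i = 0 := Subtype.ext (by simpa [v] using hc)
    simpa [hcoe] using congrArg φ hv

lemma exists_natCast_eq_mul {ι : Type*} [Finite ι] (r : ι → ℚ≥0) :
    ∃ D : ℕ, D ≠ 0 ∧ ∃ m : ι → ℕ, ∀ i, (m i : ℚ≥0) = D * r i := by
  classical
  have := Fintype.ofFinite ι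
  refine ⟨∏ i, (r i).den, Finset.prod_ne_zero_iff.2 fun i _ => (r i).den_ne_zero,
    fun i => (r i).num * ∏ j ∈ Finset.univ.erase i, (r j).den, fun i => ?_⟩
  rw [← Finset.mul_prod_erase _ _ (Finset.mem_univ i)]
  push_cast
  rw [← NNRat.den_mul_eq_num]
  ring

lemma exists_nat_weights {ι : Type*} [Fintype ι] {x : ι → ℝ} (hx : ∀ i, 0 ≤ x i) :
    ∃ m : ι → ℕ, (∀ i, m i = 0 ↔ x i = 0) ∧
      ∀ c : ι → ℤ, ∑ i, c i * x i = 0 → ∑ i, c i * (m i : ℤ) = 0 := by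
  obtain ⟨r, hr0, hr⟩ := exists_rat_weights hx
  obtain ⟨D, hD, m, hm⟩ := exists_natCast_eq_mul r
  have hm' (i : ι) : (m i : ℚ) = D * r i := mod_cast congrArg NNRat.cast (hm i)
  refine ⟨m, fun i => ?_, fun c hc => ?_⟩
  · rw [← hr0, ← Nat.cast_eq_zero (R := ℚ≥0), hm, mul_eq_zero, or_iff_right (mod_cast hD)]
  · have : ∑ i, (c i : ℚ) * m i = 0 := by
      rw [← mul_zero (D : ℚ), ← hr c hc, Finset.mul_sum]
      exact Finset.sum_congr rfl fun i _ => by rw [hm', mul_left_comm]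
    exact_mod_cast this

/-- The finite sample `τ` of the probability space `(Ω, p)` satisfies, in number of occurrences,
every integral linear relation that holds between the probabilities of the points. When the
probabilities are irrational no sample has exactly the frequencies `p`, but a balanced one exists,
and equalities between probabilities of events carry over to it. -/
def IsBalancedSample {Ω I : Type*} [Fintype Ω] [Fintype I] (p : PMF Ω) (τ : I → Ω) : Prop :=
  ∀ c : Ω → ℤ, ∑ u, c u * (p u).toReal = 0 → ∑ j, c (τ j) = 0

lemma exists_isBalancedSample {Ω : Type*} [Fintype Ω] (p : PMF Ω) {N : ℕ} (hN : 0 < N) :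
    ∃ (M : ℕ) (τ : Fin M → Ω), 0 < M ∧ N ∣ M ∧ (∀ j, p (τ j) ≠ 0) ∧ IsBalancedSample p τ := by
  obtain ⟨m, hm0, hm⟩ := exists_nat_weights (x := fun u => (p u).toReal)
    fun u => ENNReal.toReal_nonneg
  have hp (u : Ω) : m u = 0 ↔ p u = 0 := by
    rw [hm0, ENNReal.toReal_eq_zero_iff, or_iff_left (p.apply_ne_top u)]
  let e := (Fintype.equivFin (Fin N × Σ u, Fin (m u))).symm
  obtain ⟨u, hu⟩ := p.support_nonempty
  refine ⟨_, fun j => (e j).2.1, ?_, ?_, fun j => ?_, fun c hc => ?_⟩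
  · exact Fintype.card_pos_iff.2
      ⟨⟨0, hN⟩, ⟨u, ⟨0, Nat.pos_of_ne_zero fun h => hu ((hp u).1 h)⟩⟩⟩
  · rw [Fintype.card_prod, Fintype.card_fin]
    exact dvd_mul_right _ _
  · exact fun h => (e j).2.2.pos.ne' ((hp _).2 h)
  · rw [e.sum_comp fun j => c j.2.1, Fintype.sum_prod_type]
    simp only [Fintype.sum_sigma, Finset.sum_const, Finset.card_univ, Fintype.card_fin,
      nsmul_eq_mul, mul_comm _ (c _), hm c hc, mul_zero]

lemma IsBalancedSample.exists_perm {Ω I α : Type*} [Fintype Ω] [Fintype I] {p : PMF Ω}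
    {τ : I → Ω} (hτ : IsBalancedSample p τ) {f g : Ω → α} (h : p.map f = p.map g) :
    ∃ π : Equiv.Perm I, ∀ j, g (τ (π j)) = f (τ j) := by
  classical
  have hcard (a : α) : Fintype.card {j // f (τ j) = a} = Fintype.card {j // g (τ j) = a} := by
    have hrel := hτ (fun u => (if f u = a then 1 else 0) - if g u = a then 1 else 0) (by
      have := congrArg ENNReal.toReal (DFunLike.congr_fun h a)
      rw [toReal_map_apply, toReal_map_apply, Finset.sum_filter, Finset.sum_filter] at this
      simp [sub_mul, this])
    rw [Finset.sum_sub_distrib, sub_eq_zero, Finset.sum_boole, Finset.sum_boole] at hrel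
    rw [Fintype.card_subtype, Fintype.card_subtype]
    exact_mod_cast hrel
  have e (a : α) := Fintype.equivOfCardEq (hcard a)
  exact ⟨Equiv.ofFiberEquiv e, fun j => Equiv.ofFiberEquiv_map e j⟩

end BalancedSample

section Codes

/-- A linear retrieval code on `G`: when message `k` is desired, server `i` sees its stored message
`e` through the map `view k i e`, of full rank `n`, and downloads a combination, independent of `k`,
of what it sees. -/
structure RetrievalCode {V : Type} (F : Type) [Field F] (G : SimpleGraph V)
    [∀ i, Fintype (Stored G i)] (L n : ℕ) (d : V → ℕ) where
  comb : (i : V) → Stored G i → (Fin n → F) →ₗ[F] (Fin (d i) → F)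
  view : G.edgeSet → (i : V) → Stored G i → (Fin L → F) →ₗ[F] (Fin n → F)
  view_surjective : ∀ k i e, Function.Surjective (view k i e)
  decodable : ∀ (k : G.edgeSet) (w : Messages F G L),
    (∀ i, ∑ e, comb i e (view k i e (w e)) = 0) → w k = 0

/-- A linear retrieval code in which each undesired message is seen through one and the same
projection by both servers that store it. The view of message `e` at server `i` is the projection of
its image under `msgTwist k i e`; for `e ≠ k` this change of coordinates descends to the change of
coordinates `projTwist k i e` of the projected message. -/
structure AlignedCode {V : Type} (F : Type) [Field F] (G : SimpleGraph V)
    [∀ i, Fintype (Stored G i)] (L n : ℕ) (d : V → ℕ) where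
  comb : (i : V) → Stored G i → (Fin n → F) →ₗ[F] (Fin (d i) → F)
  proj : (Fin L → F) →ₗ[F] (Fin n → F)
  proj_surjective : Function.Surjective proj
  msgTwist : G.edgeSet → V → G.edgeSet → ((Fin L → F) ≃ₗ[F] (Fin L → F))
  projTwist : G.edgeSet → V → G.edgeSet → ((Fin n → F) ≃ₗ[F] (Fin n → F))
  proj_msgTwist : ∀ k i e, e ≠ k → ∀ w, proj (msgTwist k i e w) = projTwist k i e (proj w)
  decodable : ∀ (k : G.edgeSet) (w : Messages F G L),
    (∀ i, ∑ e : Stored G i, comb i e (proj (msgTwist k i e (w e))) = 0) → w k = 0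

section Alignment

variable {V F : Type} [Field F] {G : SimpleGraph V} [∀ i, Fintype (Stored G i)] {L n : ℕ}
  {d : V → ℕ}

lemma RetrievalCode.exists_view_section (C : RetrievalCode F G L n d) (k e : G.edgeSet) :
    ∃ s : (Fin n → F) →ₗ[F] (Fin L → F),
      ∀ (i : V) (hi : i ∈ (e : Sym2 V)), Function.Bijective (C.view k i ⟨e, hi⟩ ∘ₗ s) := by
  obtain ⟨e, he⟩ := e
  induction e using Sym2.ind with
  | _ a b =>
    obtain ⟨s, ha, hb⟩ := exists_common_section
      (C.view_surjective k a ⟨⟨s(a, b), he⟩, Sym2.mem_mk_left a b⟩)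
      (C.view_surjective k b ⟨⟨s(a, b), he⟩, Sym2.mem_mk_right a b⟩)
    refine ⟨s, fun i hi => ?_⟩
    rcases Sym2.mem_iff.1 hi with rfl | rfl
    exacts [ha, hb]

lemma RetrievalCode.exists_twist (C : RetrievalCode F G L n d) (k e : G.edgeSet) (i : V)
    {p : (Fin L → F) →ₗ[F] (Fin n → F)} (hp : Function.Surjective p)
    {s : (Fin n → F) →ₗ[F] (Fin L → F)}
    (hs : ∀ hi : i ∈ (e : Sym2 V), Function.Bijective (C.view k i ⟨e, hi⟩ ∘ₗ s)) :
    ∃ (c : (Fin L → F) ≃ₗ[F] (Fin L → F)) (g : (Fin n → F) ≃ₗ[F] (Fin n → F)),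
      (e ≠ k → ∀ w, p (c w) = g (p w)) ∧
      ∀ hi : i ∈ (e : Sym2 V), (e ≠ k → ∀ w, p (c w) = C.view k i ⟨e, hi⟩ (s (p w))) ∧
        (e = k → ∀ w, p (c w) = C.view k i ⟨e, hi⟩ w) := by
  by_cases hi : i ∈ (e : Sym2 V)
  · by_cases he : e = k
    · obtain ⟨c, hc⟩ := exists_equiv_comp_eq hp (C.view_surjective k i ⟨e, hi⟩)
      exact ⟨c, LinearEquiv.refl _ _, fun h => absurd he h, fun _ => ⟨fun h => absurd he h,
        fun _ => hc⟩⟩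
    · let g := LinearEquiv.ofBijective _ (hs hi)
      obtain ⟨c, hc⟩ := exists_equiv_comp_eq (Y := g.toLinearMap ∘ₗ p) hp (g.surjective.comp hp)
      exact ⟨c, g, fun _ => hc, fun _ => ⟨fun _ => hc, fun h => absurd h he⟩⟩
  · exact ⟨LinearEquiv.refl _ _, LinearEquiv.refl _ _, fun _ _ => rfl, fun h => absurd h hi⟩

/-- The section `s k e` turns the two views of an undesired message into invertible functions of
one common projection. -/
lemma RetrievalCode.exists_alignedCode (C : RetrievalCode F G L n d) (hn : n ≤ L) :
    Nonempty (AlignedCode F G L n d) := by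
  classical
  let proj : (Fin L → F) →ₗ[F] (Fin n → F) := LinearMap.funLeft F F (Fin.castLE hn)
  have hproj : Function.Surjective proj :=
    LinearMap.funLeft_surjective_of_injective F F _ (Fin.castLE_injective hn)
  choose s hs using C.exists_view_section
  choose msgTwist projTwist hdescend hview using
    fun k i e => C.exists_twist k e i hproj (hs k e i)
  refine ⟨⟨C.comb, proj, hproj, msgTwist, projTwist, hdescend, fun k w h => ?_⟩⟩
  have hdec := C.decodable k (Function.update (fun e => s k e (proj (w e))) k (w k)) fun i => by
    rw [← h i]
    refine Finset.sum_congr rfl fun e _ => congrArg _ ?_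
    by_cases he : e.1 = k
    · rw [he, Function.update_self, ← he, (hview _ i e e.2).2 rfl]
    · rw [Function.update_of_ne he, (hview k i e e.2).1 he]
  rwa [Function.update_self] at hdec

end Alignment

/-- A splitting of a vector of length `n` into parts of length `m`, one for each server other than
the distinguished server `root`. -/
structure Splitting (V F : Type*) [Field F] (n m : ℕ) where
  root : V
  part : V → (Fin n → F) →ₗ[F] (Fin m → F)
  part_root : part root = 0
  eq_zero_of_part_eq_zero : ∀ s, (∀ v, part v s = 0) → s = 0

namespace Splitting

variable {V F : Type*} [Field F] {n m : ℕ} (B : Splitting V F n m)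

/-- The answer `z` of the root is pure interference, which the other answers also contain. -/
lemma eq_of_add_part_eq {s s' : Fin n → F} {z z' : Fin m → F}
    (h : ∀ v, z + B.part v s = z' + B.part v s') : s = s' := by
  have hroot : z = z' := by simpa [B.part_root] using h B.root
  refine sub_eq_zero.1 (B.eq_zero_of_part_eq_zero _ fun v => ?_)
  rw [map_sub, sub_eq_zero]
  exact add_left_cancel (hroot ▸ h v)

variable [Fintype V]

lemma nonempty_card_sub_one_mul [Nonempty V] (m : ℕ) :
    Nonempty (Splitting V F ((Fintype.card V - 1) * m) m) := by
  classical
  let root : V := Classical.arbitrary V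
  let φ : {v // v ≠ root} × Fin m ≃ Fin ((Fintype.card V - 1) * m) :=
    Fintype.equivFinOfCardEq (by simp [Fintype.card_subtype_compl])
  refine ⟨⟨root, fun v => if h : v ≠ root then LinearMap.funLeft F F fun t => φ (⟨v, h⟩, t) else 0,
    by simp, fun s hs => ?_⟩⟩
  ext t
  obtain ⟨⟨⟨v, hv⟩, t⟩, rfl⟩ := φ.surjective t
  simpa [dif_pos hv, LinearMap.funLeft_apply] using congrFun (hs v) t

variable {E : Type*} [Fintype E]

/-- The combination, with coefficients `h`, of all parts of the vectors of a family. -/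
def combine (h : E → V → F) : (E → Fin n → F) →ₗ[F] (Fin m → F) :=
  ∑ e, ∑ v, h e v • B.part v ∘ₗ LinearMap.proj e

lemma combine_apply (h : E → V → F) (s : E → Fin n → F) :
    B.combine h s = ∑ e, ∑ v, h e v • B.part v (s e) := by
  simp [combine]

lemma combine_add_single [DecidableEq E] [DecidableEq V] (h : E → V → F) (k : E) (i : V)
    (s : E → Fin n → F) :
    B.combine (h + Pi.single k (Pi.single i 1)) s = B.combine h s + B.part i (s k) := by
  have hsingle : ∑ e, ∑ v, (Pi.single k (Pi.single i 1) : E → V → F) e v • B.part v (s e) =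
      B.part i (s k) := by
    rw [Fintype.sum_eq_single k (fun e he => by simp [Pi.single_eq_of_ne he]), Pi.single_eq_same,
      Fintype.sum_eq_single i (fun v hv => by simp [Pi.single_eq_of_ne hv]), Pi.single_eq_same,
      one_smul]
  simp only [combine_apply, Pi.add_apply, add_smul, Finset.sum_add_distrib, hsingle]

end Splitting

end Codes

section Law

variable {V F R : Type} [Fintype V] [Field F] [Fintype F] {G : SimpleGraph V}

lemma Scheme.law_apply (S : Scheme F G R) (u : S.UserRand) (w : Messages F G S.L) (r : R) :
    S.law (u, w, r) =
      S.userLaw u * ((Nat.card (Messages F G S.L) : ENNReal)⁻¹ * S.randLaw r) := by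
  classical
  let _ := Fintype.ofFinite (Messages F G S.L)
  have hmap (u' : S.UserRand) (w' : Messages F G S.L) :
      (S.randLaw.map fun r' => (u', w', r')) (u, w, r) =
        if u' = u ∧ w' = w then S.randLaw r else 0 := by
    rw [PMF.map_apply, tsum_eq_single r fun r' hr => by simp [hr.symm]]
    simp only [Prod.mk.injEq, and_true, eq_comm]
  rw [Scheme.law, PMF.bind_apply,
    tsum_eq_single u fun u' hu => by simp [hmap, hu, PMF.bind_apply], PMF.bind_apply,
    tsum_eq_single w fun w' hw => by simp [hmap, hw], hmap, PMF.uniformOfFintype_apply,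
    ← Nat.card_eq_fintype_card, if_pos ⟨rfl, rfl⟩]

lemma Scheme.law_eq_uniformOfFintype [Fintype R] [Nonempty R] (S : Scheme F G R)
    [Fintype S.UserRand] [Nonempty S.UserRand] [Fintype S.Sample] [Nonempty S.Sample]
    (hU : S.userLaw = PMF.uniformOfFintype _) (hR : S.randLaw = PMF.uniformOfFintype _) :
    S.law = PMF.uniformOfFintype S.Sample := by
  ext ⟨u, w, r⟩
  rw [S.law_apply, hU, hR]
  simp only [PMF.uniformOfFintype_apply, ← Nat.card_eq_fintype_card, Nat.card_prod, Nat.cast_mul]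
  rw [ENNReal.mul_inv (by simp) (by simp), ENNReal.mul_inv (by simp) (by simp)]

end Law

/-- What a server is told of the choices of the user: a change of coordinates for every message and
for every mask, and the coefficients of the combination of parts of masks that it has to return. -/
@[ext]
structure Coding {V : Type} (F : Type) [Field F] (G : SimpleGraph V) (L n : ℕ) where
  msg : G.edgeSet → ((Fin L → F) ≃ₗ[F] (Fin L → F))
  mask : G.edgeSet → ((Fin n → F) ≃ₗ[F] (Fin n → F))
  coeff : G.edgeSet → V → F

section Coding

variable {V F : Type} [Field F] {G : SimpleGraph V} {L n : ℕ}

instance : Nonempty (Coding F G L n) :=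
  ⟨⟨fun _ => LinearEquiv.refl _ _, fun _ => LinearEquiv.refl _ _, 0⟩⟩

instance [Finite V] [Finite F] : Finite (Coding F G L n) := by
  have hequiv (m : ℕ) : Finite ((Fin m → F) ≃ₗ[F] (Fin m → F)) := DFunLike.finite _
  refine Finite.of_injective (fun c : Coding F G L n => (c.msg, c.mask, c.coeff)) fun c c' h => ?_
  simp only [Prod.mk.injEq] at h
  exact Coding.ext h.1 h.2.1 h.2.2

end Coding

namespace AlignedCode

variable {V F : Type} [Field F] {G : SimpleGraph V} [∀ i, Fintype (Stored G i)]
  {L n m : ℕ} {d : V → ℕ} (D : AlignedCode F G L n d)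

open Classical in
/-- The coding announced to server `i` when the secret coding of the user is `c` and message `k` is
desired. -/
noncomputable def twist (k : G.edgeSet) (i : V) : Coding F G L n ≃ Coding F G L n where
  toFun c := ⟨fun e => c.msg e ≪≫ₗ D.msgTwist k i e, fun e => c.mask e ≪≫ₗ D.projTwist k i e,
    c.coeff + Pi.single k (Pi.single i 1)⟩
  invFun c := ⟨fun e => c.msg e ≪≫ₗ (D.msgTwist k i e).symm,
    fun e => c.mask e ≪≫ₗ (D.projTwist k i e).symm, c.coeff - Pi.single k (Pi.single i 1)⟩
  left_inv c := by ext <;> simp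
  right_inv c := by ext <;> simp

lemma combine_twist [Fintype V] [Fintype G.edgeSet] (B : Splitting V F n m) (k : G.edgeSet) (i : V)
    (c : Coding F G L n) (s : G.edgeSet → Fin n → F) :
    B.combine (D.twist k i c).coeff s = B.combine c.coeff s + B.part i (s k) := by
  classical
  rw [← B.combine_add_single, twist]
  congr!

/-- What server `i` returns about its messages `w` under the coding `c`: the combination of their
projections, each hidden by its mask in the family `s`. -/
def maskedData (c : Coding F G L n) (i : V) (w : Stored G i → Fin L → F)
    (s : G.edgeSet → Fin n → F) : Fin (d i) → F :=
  ∑ e, D.comb i e (D.proj (c.msg e (w e)) + c.mask e (s e))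

lemma message_eq_of_maskedData_eq {c : Coding F G L n} {k : G.edgeSet} {w w' : Messages F G L}
    {s s' : G.edgeSet → Fin n → F} (hs : s k = s' k)
    (h : ∀ i, D.maskedData (D.twist k i c) i (fun e => w e) s =
      D.maskedData (D.twist k i c) i (fun e => w' e) s') : w k = w' k := by
  classical
  obtain ⟨σ, hσ⟩ := LinearMap.exists_rightInverse_of_surjective D.proj
    (LinearMap.range_eq_top.2 D.proj_surjective)
  have hσ' (z : Fin n → F) : D.proj (σ z) = z := LinearMap.congr_fun hσ z
  let lift (e : G.edgeSet) : Fin L → F :=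
    σ (D.proj (c.msg e (w e - w' e)) + c.mask e (s e - s' e))
  have hdec := D.decodable k (Function.update lift k (c.msg k (w k - w' k))) fun i => by
    rw [← sub_eq_zero.2 (h i), maskedData, maskedData, ← Finset.sum_sub_distrib]
    refine Finset.sum_congr rfl fun e _ => ?_
    rw [← map_sub]
    congr 1
    by_cases he : e.1 = k
    · simp [twist, he, hs]
    · simp only [Function.update_of_ne he, D.proj_msgTwist k i e he, twist, lift, hσ',
        Equiv.coe_fn_mk, LinearEquiv.trans_apply, map_add, map_sub]
      abel
  rwa [Function.update_self, map_eq_zero_iff _ (c.msg k).injective, sub_eq_zero] at hdec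

/-- The change of masks that makes up for the change `δ` of the undesired messages. -/
def maskShift (c : Coding F G L n) (δ : Messages F G L) : G.edgeSet → Fin n → F :=
  fun e => (c.mask e).symm (D.proj (c.msg e (δ e)))

lemma maskShift_apply_eq_zero (c : Coding F G L n) {δ : Messages F G L} {k : G.edgeSet}
    (hδ : δ k = 0) : D.maskShift c δ k = 0 := by
  simp [maskShift, hδ]

lemma maskedData_add_sub_maskShift (c : Coding F G L n) {k : G.edgeSet} (i : V)
    {δ : Messages F G L} (hδ : δ k = 0) (w : Messages F G L) (s : G.edgeSet → Fin n → F) :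
    D.maskedData (D.twist k i c) i (fun e => (w + δ) e) (s - D.maskShift c δ) =
      D.maskedData (D.twist k i c) i (fun e => w e) s := by
  refine Finset.sum_congr rfl fun e _ => congrArg _ ?_
  by_cases he : e.1 = k
  · simp [twist, he, hδ, D.maskShift_apply_eq_zero c hδ]
  · simp [twist, maskShift, D.proj_msgTwist k i e he]

section Scheme

variable [Fintype V] [Fintype G.edgeSet] [Fintype F] (B : Splitting V F n m) (hL : 0 < L)

/-- The common randomness of the servers: a mask for every message, and a key for the private
retrieval of the mask of the desired message. -/
abbrev CommonRand {V : Type} (F : Type) (G : SimpleGraph V) (n m : ℕ) : Type :=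
  (G.edgeSet → Fin n → F) × (Fin m → F)

open Classical in
/-- The SPIR scheme of an aligned code. The private randomness of the user consists of a uniform
coding, which hides the desired index, and of a pad for the answer of each server, which makes the
answers uniform. -/
noncomputable def scheme : Scheme F G (CommonRand F G n m) where
  L := L
  L_pos := hL
  UserRand := Coding F G L n × ((i : V) → Fin (d i + m) → F)
  finite_userRand := inferInstance
  userLaw :=
    letI := Fintype.ofFinite (Coding F G L n × ((i : V) → Fin (d i + m) → F))
    PMF.uniformOfFintype _
  randLaw := PMF.uniformOfFintype _
  Query i := Coding F G L n × (Fin (d i + m) → F)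
  query k u i := (D.twist k i u.1, u.2 i)
  len i := d i + m
  answer i q w r :=
    q.2 + Fin.append (D.maskedData q.1 i w r.1) (r.2 + B.combine q.1.coeff r.1)

noncomputable instance : Fintype (D.scheme B hL).Sample :=
  Fintype.ofFinite ((Coding F G L n × ((i : V) → Fin (d i + m) → F)) ×
    Messages F G L × CommonRand F G n m)

instance : Nonempty (D.scheme B hL).Sample :=
  inferInstanceAs (Nonempty ((Coding F G L n × ((i : V) → Fin (d i + m) → F)) ×
    Messages F G L × CommonRand F G n m))

lemma scheme_law : (D.scheme B hL).law = PMF.uniformOfFintype (D.scheme B hL).Sample := by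
  classical
  let _ : Fintype (D.scheme B hL).UserRand :=
    Fintype.ofFinite (Coding F G L n × ((i : V) → Fin (d i + m) → F))
  have : Nonempty (D.scheme B hL).UserRand :=
    inferInstanceAs (Nonempty (Coding F G L n × ((i : V) → Fin (d i + m) → F)))
  exact Scheme.law_eq_uniformOfFintype _ rfl rfl

lemma scheme_A_apply (k : G.edgeSet) (i : V) (u : (D.scheme B hL).UserRand) (w : Messages F G L)
    (s : G.edgeSet → Fin n → F) (t : Fin m → F) :
    (D.scheme B hL).A k i (u, w, s, t) =
      u.2 i + Fin.append (D.maskedData (D.twist k i u.1) i (fun e => w e) s)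
        (t + B.combine (D.twist k i u.1).coeff s) :=
  rfl

lemma scheme_userPrivacy : (D.scheme B hL).UserPrivacy := by
  intro i k k'
  let π : (D.scheme B hL).Sample ≃ (D.scheme B hL).Sample :=
    Equiv.prodCongr (Equiv.prodCongr ((D.twist k i).trans (D.twist k' i).symm) (Equiv.refl _))
      (Equiv.refl _)
  have hQ (s : (D.scheme B hL).Sample) :
      (D.scheme B hL).Q k' i (π s) = (D.scheme B hL).Q k i s :=
    Prod.ext ((D.twist k' i).apply_symm_apply _) rfl
  have hA (s : (D.scheme B hL).Sample) :
      (D.scheme B hL).A k' i (π s) = (D.scheme B hL).A k i s := by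
    rw [Scheme.A, hQ]
    rfl
  rw [scheme_law, ← map_uniformOfFintype_comp_equiv (fun s => ((D.scheme B hL).Q k' i s, _)) π]
  simp only [hQ, hA]
  rfl

lemma scheme_reliable : (D.scheme B hL).Reliable := by
  refine fun k => condEntropy_eq_zero_of_function _ _ ?_
  rintro ⟨u, w, s, t⟩ ⟨u', w', s', t'⟩ h
  obtain ⟨hA, hU⟩ := Prod.mk.inj h
  obtain rfl : u = u' := hU
  have hpart (i : V) :
      D.maskedData (D.twist k i u.1) i (fun e => w e) s =
          D.maskedData (D.twist k i u.1) i (fun e => w' e) s' ∧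
        t + B.combine (D.twist k i u.1).coeff s = t' + B.combine (D.twist k i u.1).coeff s' :=
    Prod.mk.inj ((Fin.appendEquiv _ _).injective
      (a₁ := (_, _)) (a₂ := (_, _)) (add_left_cancel (congrFun hA i)))
  have hmask : s k = s' k := by
    refine B.eq_of_add_part_eq (z := t + B.combine u.1.coeff s) (z' := t' + B.combine u.1.coeff s')
      fun i => ?_
    simpa only [D.combine_twist, add_assoc] using (hpart i).2
  exact D.message_eq_of_maskedData_eq hmask fun i => (hpart i).1

lemma exists_equiv_translate_messages (k : G.edgeSet)
    (δ : {e : G.edgeSet // e ≠ k} → Fin (D.scheme B hL).L → F) :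
    ∃ π : (D.scheme B hL).Sample ≃ (D.scheme B hL).Sample, ∀ s,
      (D.scheme B hL).WOther k (π s) = (D.scheme B hL).WOther k s + δ ∧
      (D.scheme B hL).AAll k (π s) = (D.scheme B hL).AAll k s ∧
      (D.scheme B hL).U (π s) = (D.scheme B hL).U s := by
  classical
  let ε : Messages F G L := fun e => if h : e ≠ k then δ ⟨e, h⟩ else 0
  have hε : ε k = 0 := dif_neg (not_not.2 rfl)
  let shift (c : Coding F G L n) : Messages F G L × CommonRand F G n m :=
    (ε, -D.maskShift c ε, B.combine c.coeff (D.maskShift c ε))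
  refine ⟨Equiv.prodShear (Equiv.refl _) fun u => Equiv.addRight (shift u.1),
    fun ⟨u, (w : Messages F G L), s, t⟩ => ⟨?_, ?_, rfl⟩⟩
  · ext1 e
    exact congrArg (w e + ·) (dif_pos e.2)
  · ext1 i
    change (D.scheme B hL).A k i
      (u, w + ε, s + -D.maskShift u.1 ε, t + B.combine u.1.coeff (D.maskShift u.1 ε)) =
        (D.scheme B hL).A k i (u, w, s, t)
    have hkey : t + B.combine u.1.coeff (D.maskShift u.1 ε) +
        B.combine (D.twist k i u.1).coeff (s - D.maskShift u.1 ε) =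
          t + B.combine (D.twist k i u.1).coeff s := by
      simp only [D.combine_twist, map_sub, Pi.sub_apply, D.maskShift_apply_eq_zero u.1 hε,
        sub_zero]
      abel
    rw [scheme_A_apply, scheme_A_apply, ← sub_eq_add_neg, hkey,
      D.maskedData_add_sub_maskShift u.1 i hε]

lemma scheme_databasePrivacy : (D.scheme B hL).DatabasePrivacy := by
  classical
  intro k
  rw [condMutualInfo, scheme_law, condEntropy_uniformOfFintype, condEntropy_uniformOfFintype,
    sub_self]
  · intro δ
    obtain ⟨π, hπ⟩ := D.exists_equiv_translate_messages B hL k δ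
    exact ⟨π, fun s => ⟨(hπ s).1, Prod.ext (hπ s).2.1 (hπ s).2.2⟩⟩
  · intro δ
    obtain ⟨π, hπ⟩ := D.exists_equiv_translate_messages B hL k δ
    exact ⟨π, fun s => ⟨(hπ s).1, (hπ s).2.2⟩⟩

lemma scheme_isSPIR : (D.scheme B hL).IsSPIR :=
  ⟨D.scheme_userPrivacy B hL, D.scheme_reliable B hL, D.scheme_databasePrivacy B hL⟩

lemma exists_equiv_translate_answer (k : G.edgeSet) (i : V)
    (δ : Fin ((D.scheme B hL).len i) → F) :
    ∃ π : (D.scheme B hL).Sample ≃ (D.scheme B hL).Sample, ∀ s,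
      (D.scheme B hL).A k i (π s) = (D.scheme B hL).A k i s + δ := by
  classical
  let ε : Fin (d i + m) → F := δ
  refine ⟨Equiv.prodCongr (Equiv.prodCongr (Equiv.refl _) (Equiv.addRight (Pi.single i ε)))
    (Equiv.refl _), fun ⟨u, w, s, t⟩ => ?_⟩
  let data : Fin (d i + m) → F :=
    Fin.append (D.maskedData (D.twist k i u.1) i (fun e => w e) s)
      (t + B.combine (D.twist k i u.1).coeff s)
  change u.2 i + (Pi.single i ε : (j : V) → Fin (d j + m) → F) i + data = u.2 i + data + ε
  rw [Pi.single_eq_same, add_right_comm]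

lemma scheme_entropy_A (k : G.edgeSet) (i : V) :
    entropy (Fintype.card F) (D.scheme B hL).law ((D.scheme B hL).A k i) = d i + m := by
  classical
  have hF : (1 : ℝ) < Fintype.card F := Nat.one_lt_cast.2 Fintype.one_lt_card
  rw [scheme_law, entropy_uniformOfFintype]
  · have hcard : Fintype.card (Fin ((D.scheme B hL).len i) → F) = Fintype.card F ^ (d i + m) := by
      rw [Fintype.card_fun, Fintype.card_fin]
      rfl
    rw [hcard, Nat.cast_pow, Real.logb_pow, Real.logb_self_eq_one hF, mul_one, Nat.cast_add]
  · exact D.exists_equiv_translate_answer B hL k i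

lemma scheme_entropy_rand :
    entropy (Fintype.card F) (D.scheme B hL).law (D.scheme B hL).Rand =
      Fintype.card G.edgeSet * n + m := by
  classical
  have hF : (1 : ℝ) < Fintype.card F := Nat.one_lt_cast.2 Fintype.one_lt_card
  rw [scheme_law, entropy_uniformOfFintype]
  · have hcard : Fintype.card (CommonRand F G n m) =
        Fintype.card F ^ (Fintype.card G.edgeSet * n + m) := by
      rw [Fintype.card_prod, Fintype.card_fun, Fintype.card_fun, Fintype.card_fun,
        Fintype.card_fin, Fintype.card_fin, ← pow_mul, ← pow_add, mul_comm n]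
    rw [hcard, Nat.cast_pow, Real.logb_pow, Real.logb_self_eq_one hF]
    push_cast
    ring
  · exact fun δ => ⟨Equiv.prodCongr (Equiv.refl _)
      (Equiv.prodCongr (Equiv.refl _) (Equiv.addRight δ)), fun _ => rfl⟩

lemma scheme_rate (k : G.edgeSet) :
    (D.scheme B hL).rate k = L / (∑ i, (d i : ℝ) + Fintype.card V * m) := by
  rw [Scheme.rate]
  simp only [scheme_entropy_A, Finset.sum_add_distrib, Finset.sum_const, Finset.card_univ,
    nsmul_eq_mul]
  rfl

lemma scheme_totalRandRatio :
    (D.scheme B hL).totalRandRatio = (Fintype.card G.edgeSet * n + m) / L := by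
  rw [Scheme.totalRandRatio, scheme_entropy_rand]
  rfl

end Scheme

end AlignedCode

section LinearPIR

variable {V F : Type} [Field F] {G : SimpleGraph V}

section AnswerMap

variable {T : PIRScheme F G} (hlin : T.IsLinear) (i : V) (q : T.Query i)

/-- The answer of server `i` of a linear scheme to the query `q`, as a linear map on the stored
messages. -/
def Scheme.answerMap : (Stored G i → Fin T.L → F) →ₗ[F] (Fin (T.len i) → F) :=
  (hlin i q).mk' _

open Classical in
/-- The part of an answer of a linear scheme that comes from the stored message `e`. -/
noncomputable def Scheme.edgeMap (e : Stored G i) :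
    (Fin T.L → F) →ₗ[F] (Fin (T.len i) → F) :=
  Scheme.answerMap hlin i q ∘ₗ LinearMap.single F (fun _ => Fin T.L → F) e

lemma Scheme.answerMap_eq_sum_edgeMap [Fintype (Stored G i)] (w : Stored G i → Fin T.L → F) :
    Scheme.answerMap hlin i q w = ∑ e, Scheme.edgeMap hlin i q e (w e) := by
  classical
  conv_lhs => rw [← Finset.univ_sum_single w, map_sum]
  refine Finset.sum_congr rfl fun e _ => ?_
  rw [Scheme.edgeMap]
  congr!

lemma Scheme.map_ker_answerMap_eq_range_edgeMap {k : G.edgeSet} (hi : i ∈ (k : Sym2 V)) :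
    (LinearMap.funLeft F (Fin T.L → F)
      fun e : {e : Stored G i // e.1 ≠ k} => e.1.1).ker.map
        (Scheme.answerMap hlin i q ∘ₗ LinearMap.funLeft F (Fin T.L → F) Subtype.val) =
      (Scheme.edgeMap hlin i q ⟨k, hi⟩).range := by
  classical
  have hrestrict (w : Messages F G T.L) (hw : ∀ e : Stored G i, e.1 ≠ k → w e.1 = 0) :
      LinearMap.funLeft F (Fin T.L → F) Subtype.val w =
        (Pi.single ⟨k, hi⟩ (w k) : Stored G i → Fin T.L → F) := by
    ext1 e
    by_cases he : e.1 = k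
    · obtain rfl : e = ⟨k, hi⟩ := Subtype.ext he
      rw [Pi.single_eq_same, LinearMap.funLeft_apply]
    · rw [Pi.single_eq_of_ne fun h => he (congrArg Subtype.val h)]
      exact hw e he
  apply le_antisymm
  · rintro _ ⟨w, hw, rfl⟩
    refine ⟨w k, ?_⟩
    rw [LinearMap.comp_apply, hrestrict w fun e he => congrFun hw ⟨e, he⟩, Scheme.edgeMap]
    congr!
  · rintro _ ⟨v, rfl⟩
    have hv (e : Stored G i) (he : e.1 ≠ k) : (Pi.single k v : Messages F G T.L) e.1 = 0 :=
      Pi.single_eq_of_ne (M := fun _ => Fin T.L → F) he v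
    refine ⟨Pi.single k v, funext fun e => hv e.1 e.2, ?_⟩
    rw [LinearMap.comp_apply, hrestrict _ hv, Pi.single_eq_same, Scheme.edgeMap]
    congr!

end AnswerMap

variable [Fintype V] [Fintype F]

lemma Scheme.map_law_user {R : Type} (S : Scheme F G R) :
    S.law.map Prod.fst = S.userLaw := by
  rw [Scheme.law, PMF.map_bind]
  simp only [PMF.map_bind, PMF.map_comp]
  have hconst (u : S.UserRand) (w : Messages F G S.L) :
      PMF.map (Prod.fst ∘ fun r => (u, w, r)) S.randLaw = PMF.pure u :=
    PMF.map_const _ _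
  simp only [hconst, PMF.bind_const, PMF.bind_pure]

lemma Scheme.map_law_messages {R : Type} (S : Scheme F G R) [Fintype (Messages F G S.L)] :
    S.law.map (fun s => s.2.1) = PMF.uniformOfFintype (Messages F G S.L) := by
  rw [Scheme.law, PMF.map_bind]
  simp only [PMF.map_bind, PMF.map_comp]
  have hconst (u : S.UserRand) (w : Messages F G S.L) :
      PMF.map ((fun s : S.Sample => s.2.1) ∘ fun r => (u, w, r)) S.randLaw = PMF.pure w :=
    PMF.map_const _ _
  simp only [hconst, PMF.bind_const, PMF.bind_pure]
  congr!

lemma Scheme.entropy_message {R : Type} (S : Scheme F G R) (k : G.edgeSet) :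
    entropy (Fintype.card F) S.law (S.W k) = S.L := by
  classical
  let _ := Fintype.ofFinite (Messages F G S.L)
  have hmap : entropy (Fintype.card F) S.law (S.W k) =
      entropy (Fintype.card F) (PMF.uniformOfFintype (Messages F G S.L)) fun w => w k := by
    rw [entropy, entropy, ← S.map_law_messages, PMF.map_comp]
    rfl
  rw [hmap, entropy_uniformOfFintype]
  · rw [Fintype.card_fun, Fintype.card_fin, Nat.cast_pow, Real.logb_pow,
      Real.logb_self_eq_one (Nat.one_lt_cast.2 Fintype.one_lt_card), mul_one]
  · exact fun δ => ⟨Equiv.addRight (Pi.single k δ), fun w => by simp⟩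

lemma Scheme.UserPrivacy.map_query_eq {R : Type} {S : Scheme F G R} (h : S.UserPrivacy) (i : V)
    (k k' : G.edgeSet) :
    S.userLaw.map (fun u => S.query k u i) = S.userLaw.map fun u => S.query k' u i := by
  have hquery (k : G.edgeSet) :
      (S.law.map fun s => (S.Q k i s, S.A k i s, S.WStored i s, S.Rand s)).map Prod.fst =
        S.userLaw.map fun u => S.query k u i := by
    rw [← S.map_law_user, PMF.map_comp, PMF.map_comp]
    rfl
  rw [← hquery, h i k k', hquery]

variable {T : PIRScheme F G}

lemma Scheme.Reliable.eq_zero_of_answerMap_eq_zero (h : T.Reliable) (hlin : T.IsLinear)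
    {k : G.edgeSet} {u : T.UserRand} (hu : T.userLaw u ≠ 0) {w : Messages F G T.L}
    (hw : ∀ i, Scheme.answerMap hlin i (T.query k u i) (fun e => w e) = 0) : w k = 0 := by
  have := T.finite_userRand
  have hpos (w : Messages F G T.L) : T.law (u, w, ()) ≠ 0 := by
    rw [T.law_apply, apply_eq_one_of_unique T.randLaw]
    simp [hu]
  refine eq_of_condEntropy_eq_zero Fintype.one_lt_card (h k) (hpos w) (hpos 0) ?_
  refine Prod.ext (funext fun i => (hw i).trans ?_) rfl
  exact (map_zero (Scheme.answerMap hlin i (T.query k u i))).symm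

lemma Scheme.toReal_map_law_prodMk {α β : Type*} (a : T.UserRand → α) (b : Messages F G T.L → β)
    (x : α) (y : β) :
    (T.law.map (fun s => (a s.1, b s.2.1)) (x, y)).toReal =
      (T.userLaw.map a x).toReal *
        (Nat.card {w // b w = y} * (Nat.card (Messages F G T.L) : ℝ)⁻¹) := by
  classical
  have := T.finite_userRand
  let _ := Fintype.ofFinite T.UserRand
  let _ := Fintype.ofFinite (Messages F G T.L)
  have hlaw (u : T.UserRand) (w : Messages F G T.L) (r : Unit) : (T.law (u, w, r)).toReal =
      (T.userLaw u).toReal * (Nat.card (Messages F G T.L) : ℝ)⁻¹ := by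
    rw [T.law_apply, apply_eq_one_of_unique T.randLaw]
    simp
  rw [toReal_map_apply, toReal_map_apply, Finset.sum_filter, Finset.sum_filter,
    Nat.card_eq_fintype_card, Fintype.card_subtype, ← nsmul_eq_mul, ← Finset.sum_const,
    Finset.sum_filter, Finset.sum_mul_sum, Fintype.sum_prod_type]
  refine Finset.sum_congr rfl fun u _ => ?_
  rw [Fintype.sum_prod_type]
  refine Finset.sum_congr rfl fun w _ => ?_
  rw [Fintype.sum_unique, hlaw, ite_zero_mul_ite_zero]
  simp only [Prod.mk.injEq]

/-- Given its query and the undesired messages, the answer of a linear scheme is uniform on a coset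
of the range of `edgeMap`. -/
lemma Scheme.condEntropy_answer [Fintype T.UserRand] (hlin : T.IsLinear) {k : G.edgeSet} {i : V}
    (hi : i ∈ (k : Sym2 V)) :
    condEntropy (Fintype.card F) T.law (T.A k i) (fun s => (T.Q k i s, T.WStoredOther i k s)) =
      ∑ u, (T.userLaw u).toReal *
        Module.finrank F (Scheme.edgeMap hlin i (T.query k u i) ⟨k, hi⟩).range := by
  classical
  let _ := Fintype.ofFinite T.Sample
  let f : Messages F G T.L →ₗ[F] ({e : Stored G i // e.1 ≠ k} → Fin T.L → F) :=
    LinearMap.funLeft F (Fin T.L → F) fun e => e.1.1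
  let g (q : T.Query i) : Messages F G T.L →ₗ[F] (Fin (T.len i) → F) :=
    Scheme.answerMap hlin i q ∘ₗ LinearMap.funLeft F (Fin T.L → F) Subtype.val
  rw [condEntropy_eq_sum_of_toReal_map_eq_mul fun s => (Fintype.card F : ℝ) ^
    Module.finrank F (Scheme.edgeMap hlin i (T.query k s.1 i) ⟨k, hi⟩).range]
  · simp only [Real.logb_pow,
      Real.logb_self_eq_one (Nat.one_lt_cast.2 (Fintype.one_lt_card (α := F))), mul_one]
    rw [← T.map_law_user, sum_toReal_map_mul]
  · intro s
    have hjoint : T.law.map (fun t => (T.A k i t, T.Q k i t, T.WStoredOther i k t))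
          (T.A k i s, T.Q k i s, T.WStoredOther i k s) =
        T.law.map (fun t => (T.query k t.1 i, g (T.query k s.1 i) t.2.1, f t.2.1))
          (T.query k s.1 i, g (T.query k s.1 i) s.2.1, f s.2.1) := by
      refine map_apply_congr _ fun t => ?_
      simp only [Prod.mk.injEq]
      refine ⟨fun ⟨hA, hQ, hW⟩ => ⟨hQ, ?_, hW⟩, fun ⟨hQ, hA, hW⟩ => ⟨?_, hQ, hW⟩⟩
      · rwa [Scheme.A, Scheme.A, hQ] at hA
      · have hQ' : T.Q k i t = T.Q k i s := hQ
        rw [Scheme.A, Scheme.A, hQ']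
        exact hA
    have hfiber := natCard_fiber_eq_pow_mul f (g (T.query k s.1 i)) s.2.1
    rw [Scheme.map_ker_answerMap_eq_range_edgeMap hlin i _ hi,
      Nat.card_eq_fintype_card (α := F)] at hfiber
    rw [hjoint, Scheme.toReal_map_law_prodMk (fun u => T.query k u i)
      (fun w => (g (T.query k s.1 i) w, f w))]
    refine (Scheme.toReal_map_law_prodMk (fun u => T.query k u i) f (T.query k s.1 i)
      (f s.2.1)).trans ?_
    rw [hfiber]
    push_cast
    ring

lemma IsBalancedSample.two_mul_sum_finrank_eq [Fintype T.UserRand] {I : Type*} [Fintype I]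
    {τ : I → T.UserRand} (hτ : IsBalancedSample T.userLaw τ) (h : T.SymmetricRetrieval)
    (hlin : T.IsLinear) {k : G.edgeSet} {i : V} (hi : i ∈ (k : Sym2 V)) :
    2 * ∑ j, Module.finrank F (Scheme.edgeMap hlin i (T.query k (τ j) i) ⟨k, hi⟩).range =
      Fintype.card I * T.L := by
  have hmean := h k i hi
  rw [T.entropy_message, Scheme.condEntropy_answer hlin hi] at hmean
  let rk (u : T.UserRand) : ℕ :=
    Module.finrank F (Scheme.edgeMap hlin i (T.query k u i) ⟨k, hi⟩).range
  have hterm (u : T.UserRand) : ((2 * rk u - T.L : ℤ) : ℝ) * (T.userLaw u).toReal =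
      2 * ((T.userLaw u).toReal * rk u) - T.L * (T.userLaw u).toReal := by
    push_cast
    ring
  have hsample := hτ (fun u => 2 * rk u - T.L) (by
    simp only [hterm, Finset.sum_sub_distrib, ← Finset.mul_sum, sum_toReal]
    linear_combination 2 * hmean)
  rw [Finset.sum_sub_distrib, ← Finset.mul_sum, Finset.sum_const, Finset.card_univ, nsmul_eq_mul,
    sub_eq_zero] at hsample
  exact_mod_cast hsample

/-- The isomorphism that concatenates `M` blocks of length `a`. -/
def blockEquiv (F : Type) [Field F] (M a : ℕ) : (Fin M → Fin a → F) ≃ₗ[F] (Fin (M * a) → F) :=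
  (LinearEquiv.curry F F (Fin M) (Fin a)).symm ≪≫ₗ LinearEquiv.funCongrLeft F F finProdFinEquiv.symm

/-- One copy of the scheme is run for every element of the sample. On a balanced sample the queries
for any two desired messages agree up to a permutation of the copies, so that the server combines
what it sees independently of the desired message. -/
lemma IsBalancedSample.exists_retrievalCode [Fintype T.UserRand] [Nonempty G.edgeSet]
    [∀ i, Fintype (Stored G i)] {M n : ℕ} {τ : Fin M → T.UserRand}
    (hτ : IsBalancedSample T.userLaw τ) (hsupp : ∀ j, T.userLaw (τ j) ≠ 0) (hT : T.IsPIR)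
    (hlin : T.IsLinear) (hSRP : T.SymmetricRetrieval) (hn : 2 * n = M * T.L) :
    Nonempty (RetrievalCode F G (M * T.L) n fun i => M * T.len i) := by
  let k₀ : G.edgeSet := Classical.arbitrary _
  choose π hπ using fun (k : G.edgeSet) (i : V) => hτ.exists_perm (hT.1.map_query_eq i k k₀)
  have hrank (i : V) (e : Stored G i) :
      ∑ j, Module.finrank F (Scheme.edgeMap hlin i (T.query k₀ (τ j) i) e).range = n := by
    have h := hτ.two_mul_sum_finrank_eq hSRP hlin e.2
    rw [Fintype.card_fin, ← hn] at h
    refine (Fintype.sum_equiv (π e i) _ _ fun j => ?_).symm.trans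
      (Nat.eq_of_mul_eq_mul_left two_pos h)
    rw [hπ]
  choose C X hX hCX using fun i (e : Stored G i) => exists_factorization_pi _ (hrank i e)
  refine ⟨⟨fun i e => blockEquiv F M (T.len i) ∘ₗ C i e, fun k i e => X i e ∘ₗ
    LinearMap.funLeft F (Fin T.L → F) (π k i).symm ∘ₗ (blockEquiv F M T.L).symm,
    fun k i e => (hX i e).comp ((LinearMap.funLeft_surjective_of_injective F (Fin T.L → F) _
      (π k i).symm.injective).comp (blockEquiv F M T.L).symm.surjective), fun k w hw => ?_⟩⟩
  rw [← map_eq_zero_iff _ (blockEquiv F M T.L).symm.injective]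
  ext1 j
  refine hT.2.eq_zero_of_answerMap_eq_zero hlin (hsupp j)
    (w := fun e => (blockEquiv F M T.L).symm (w e) j) fun i => ?_
  have hblocks : ∑ e : Stored G i, (fun j' => Scheme.edgeMap hlin i (T.query k₀ (τ j') i) e
      ((blockEquiv F M T.L).symm (w e) ((π k i).symm j'))) = 0 := by
    rw [← map_eq_zero_iff _ (blockEquiv F M (T.len i)).injective, map_sum, ← hw i]
    exact Finset.sum_congr rfl fun e _ => congrArg (blockEquiv F M (T.len i)) (hCX i e _).symm
  have hblock := congrFun hblocks (π k i j)
  rw [Finset.sum_apply, Pi.zero_apply] at hblock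
  simpa only [Equiv.symm_apply_apply, hπ, ← Scheme.answerMap_eq_sum_edgeMap] using hblock

end LinearPIR

lemma one_lt_card_of_nonempty_edgeSet {V : Type*} [Fintype V] (G : SimpleGraph V)
    [hG : Nonempty G.edgeSet] : 1 < Fintype.card V := by
  obtain ⟨⟨e, he⟩⟩ := hG
  induction e using Sym2.ind with
  | _ a b => exact Fintype.one_lt_card_iff.2 ⟨a, b, G.ne_of_adj he⟩

section Arithmetic

variable {L N l x y : ℕ}

lemma mul_lcm_div_eq (hL : Even L) (hN : 1 < N) (hl : l = Nat.lcm (L / 2) (N - 1))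
    (hx : x = l / (L / 2)) (hy : y = l / (N - 1)) : (L * x : ℝ) = 2 * (N - 1) * y := by
  have hlx : L / 2 * x = l := by rw [hx, hl, Nat.mul_div_cancel' (Nat.dvd_lcm_left _ _)]
  have hly : (N - 1) * y = l := by rw [hy, hl, Nat.mul_div_cancel' (Nat.dvd_lcm_right _ _)]
  have hhalf := Nat.two_mul_div_two_of_even hL
  have hnat : L * x = 2 * ((N - 1) * y) := by rw [← hhalf, mul_assoc, hlx, hly]
  rw [mul_assoc, ← Nat.cast_pred (by omega : 0 < N)]
  exact_mod_cast hnat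

lemma lcm_div_pos (hL : Even L) (hL0 : 0 < L) (hN : 1 < N) (hl : l = Nat.lcm (L / 2) (N - 1))
    (hx : x = l / (L / 2)) : 0 < x := by
  have hhalf := Nat.two_mul_div_two_of_even hL
  rw [hx, hl]
  exact Nat.div_pos (Nat.le_of_dvd (Nat.lcm_pos (by omega) (by omega)) (Nat.dvd_lcm_left _ _))
    (by omega)

lemma mul_lcm_div_div_eq (hL : Even L) (hL0 : 0 < L) (hN : 1 < N)
    (hl : l = Nat.lcm (L / 2) (N - 1)) (hx : x = l / (L / 2)) (hy : y = l / (N - 1)) :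
    (N * y / (L * x) : ℝ) = N / (2 * (N - 1)) := by
  have hLx : (L * x : ℝ) ≠ 0 := by
    exact_mod_cast (Nat.mul_pos hL0 (lcm_div_pos hL hL0 hN hl hx)).ne'
  have hN1 : (2 * (N - 1) : ℝ) ≠ 0 :=
    mul_ne_zero two_ne_zero (sub_ne_zero.2 (by exact_mod_cast hN.ne'))
  rw [div_eq_div_iff hLx hN1, mul_lcm_div_eq hL hN hl hx hy]
  ring

lemma lcm_rate_eq (hL : Even L) (hL0 : 0 < L) (hN : 1 < N)
    (hl : l = Nat.lcm (L / 2) (N - 1)) (hx : x = l / (L / 2)) (hy : y = l / (N - 1)) (D : ℝ) :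
    (L * x / (D * x + N * y) : ℝ) = L / (D + L * (N / (2 * (N - 1)))) := by
  have hx0 : (x : ℝ) ≠ 0 := by exact_mod_cast (lcm_div_pos hL hL0 hN hl hx).ne'
  have hL1 : (L : ℝ) ≠ 0 := by exact_mod_cast hL0.ne'
  rw [← mul_lcm_div_div_eq hL hL0 hN hl hx hy, ← mul_div_mul_right (L : ℝ) _ hx0]
  congr 1
  field_simp

end Arithmetic

variable {V F : Type} [Fintype V] [Field F] [Fintype F] {G : SimpleGraph V} [Nonempty G.edgeSet]

lemma exists_isSPIR_of_linear (T : PIRScheme F G) (hT : T.IsPIR) (hlin : T.IsLinear)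
    (hSRP : T.SymmetricRetrieval) :
    ∃ (R : Type) (_ : Finite R) (S : Scheme F G R), S.IsSPIR ∧
      (∀ k, S.rate k = T.L / (T.downloads +
        T.L * (Fintype.card V / (2 * (Fintype.card V - 1) : ℝ)))) ∧
      S.totalRandRatio = ((Nat.card G.edgeSet : ℝ) - 1) / 2 +
        Fintype.card V / (2 * (Fintype.card V - 1) : ℝ) := by
  classical
  have := T.finite_userRand
  let _ := Fintype.ofFinite T.UserRand
  let _ := Fintype.ofFinite G.edgeSet
  let _ (i : V) := Fintype.ofFinite (Stored G i)
  have hV := one_lt_card_of_nonempty_edgeSet G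
  have : Nonempty V := Fintype.card_pos_iff.1 (by omega)
  obtain ⟨M, τ, hM, ⟨c, hc⟩, hsupp, hτ⟩ :=
    exists_isBalancedSample T.userLaw (N := 2 * (Fintype.card V - 1)) (by omega)
  let m := c * T.L
  have hn : 2 * ((Fintype.card V - 1) * m) = M * T.L := by rw [hc]; ring
  have hL : 0 < M * T.L := Nat.mul_pos hM T.L_pos
  obtain ⟨C⟩ := hτ.exists_retrievalCode hsupp hT hlin hSRP hn
  obtain ⟨D⟩ := C.exists_alignedCode (by omega)
  obtain ⟨B⟩ := Splitting.nonempty_card_sub_one_mul (V := V) (F := F) m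
  have hM' : (M : ℝ) ≠ 0 := Nat.cast_ne_zero.2 hM.ne'
  have hL' : (T.L : ℝ) ≠ 0 := Nat.cast_ne_zero.2 T.L_pos.ne'
  have hpred : ((Fintype.card V - 1 : ℕ) : ℝ) = Fintype.card V - 1 := Nat.cast_pred (by omega)
  have hV' : (Fintype.card V - 1 : ℝ) ≠ 0 := by rw [← hpred]; exact Nat.cast_ne_zero.2 (by omega)
  have hm : (m : ℝ) = M * T.L / (2 * (Fintype.card V - 1)) := by
    rw [eq_div_iff (by simpa using hV'), ← hpred]
    exact_mod_cast (by rw [← hn]; ring : m * (2 * (Fintype.card V - 1)) = M * T.L)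
  refine ⟨_, inferInstance, D.scheme B hL, D.scheme_isSPIR B hL, fun k => ?_, ?_⟩
  · rw [D.scheme_rate, hm, Scheme.downloads, ← mul_div_mul_left (T.L : ℝ) _ hM']
    push_cast
    rw [← Finset.mul_sum]
    congr 1
    ring
  · rw [D.scheme_totalRandRatio, Nat.card_eq_fintype_card]
    push_cast
    rw [hpred, hm]
    field_simp
    ring

end GraphPIR

theorem theorem5_general {V F : Type} [Fintype V] [Field F] [Fintype F] (G : SimpleGraph V)
    [Nonempty G.edgeSet] (T : GraphPIR.PIRScheme F G) (hT : T.IsPIR) (hlin : T.IsLinear)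
    (hSRP : T.SymmetricRetrieval) :
    (∃ (R : Type) (_ : Finite R) (S : GraphPIR.Scheme F G R), S.IsSPIR ∧
      (∀ k, S.rate k = (T.L : ℝ) / (T.downloads +
        T.L * (Fintype.card V / (2 * (Fintype.card V - 1))))) ∧
      S.totalRandRatio = ((Nat.card G.edgeSet : ℝ) - 1) / 2 +
        Fintype.card V / (2 * (Fintype.card V - 1))) ∧
    (((T.L : ℝ) / (T.downloads + T.L * (Fintype.card V / (2 * (Fintype.card V - 1)))) : ℝ) :
      EReal) ≤ GraphPIR.capacityFR F G ∧
    GraphPIR.optTotalRandRatio F G ≤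
      ((((Nat.card G.edgeSet : ℝ) - 1) / 2 +
        Fintype.card V / (2 * (Fintype.card V - 1)) : ℝ) : EReal) := by
  obtain ⟨R, hR, S, hS, hrate, hrand⟩ := GraphPIR.exists_isSPIR_of_linear T hT hlin hSRP
  exact ⟨⟨R, hR, S, hS, hrate, hrand⟩, le_sSup ⟨R, hR, S, hS, fun k => by rw [hrate k]⟩,
    sInf_le ⟨R, hR, S, hS, by rw [hrand]⟩⟩

theorem theorem5 {V F : Type} [Fintype V] [Field F] [Fintype F] (G : SimpleGraph V)
    (hG : G.Connected) (N K : ℕ) (hN : N = Fintype.card V) (hK : K = Nat.card G.edgeSet)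
    (hK2 : 2 ≤ K)
    (T : GraphPIR.PIRScheme F G) (hT : T.IsPIR) (hlin : T.IsLinear)
    (hSRP : T.SymmetricRetrieval) (heven : Even T.L)
    (L' D' l x y : ℕ) (hL' : L' = T.L) (hD' : D' = T.downloads)
    (hl : l = Nat.lcm (L' / 2) (N - 1)) (hx : x = l / (L' / 2)) (hy : y = l / (N - 1)) :
    (∃ (R : Type) (_ : Finite R) (S : GraphPIR.Scheme F G R), S.IsSPIR ∧
      (∀ k, S.rate k = ((L' : ℝ) * x) / (D' * x + N * y)) ∧
      S.totalRandRatio = ((K : ℝ) - 1) / 2 + (N * y : ℝ) / (L' * x)) ∧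
    (((((L' : ℝ) * x) / (D' * x + N * y) : ℝ)) : EReal) ≤ GraphPIR.capacityFR F G ∧
    GraphPIR.optTotalRandRatio F G ≤
      (((((K : ℝ) - 1) / 2 + (N * y : ℝ) / (L' * x) : ℝ)) : EReal) := by
  have : Nonempty G.edgeSet := (Nat.card_pos_iff.1 (by omega)).1
  have hN1 : 1 < N := hN ▸ GraphPIR.one_lt_card_of_nonempty_edgeSet G
  have hL0 : 0 < L' := hL' ▸ T.L_pos
  rw [GraphPIR.lcm_rate_eq (hL' ▸ heven) hL0 hN1 hl hx hy,
    GraphPIR.mul_lcm_div_div_eq (hL' ▸ heven) hL0 hN1 hl hx hy, hL', hD', hN, hK]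
  exact theorem5_general G T hT hlin hSRP
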